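/- Let $L>0$ and let $m,n$ be continuous functions on $[0,L]$ that are bounded below by a positive constant. For $k\ge 0$ let $\mathcal C_k^+$ (resp. $\mathcal C_k^-$) be the set of pairs $(\alpha,\beta)$ for which the problem $$-u''=\alpha\,m(x)\,u^+-\beta\,n(x)\,u^-\ \text{ in }(0,L),\qquad u(0)=u(L)=0,\qquad u^\pm=\max\{0,\pm u\},$$ has a (nontrivial) solution with exactly $k$ zeros in $(0,L)$ and with $u'(0)>0$ (resp. $u'(0)<0$). For $\theta\in(0,\pi/2)$ let $\mathcal K_\theta$ be the closed region of the open first quadrant between the two rays through the origin that form an angle $\theta$ with each other and are symmetric to each other with respect to the line $\beta=\alpha$; that is, the set of $(\alpha,\beta)$ with $\alpha,\beta>0$ whose slope $\beta/\alpha$ lies in $[\tan(\frac\pi4-\frac\theta2),\tan(\frac\pi4+\frac\theta2)]$. Fix $\theta\in(0,\pi/2)$. Then for points $(\alpha_k^\pm,\beta_k^\pm)\in\mathcal C_k^\pm\cap\mathcal K_\theta$, $$1\sim\frac{\pi k}{2}\left(\int_0^L\Big((\alpha_k^\pm m)^{-1/2}+(\beta_k^\pm n)^{-1/2}\Big)^{-1}dx\right)^{-1}\qquad(k\to\infty),$$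 that is, the quotient of the two sides tends to $1$, uniformly with respect to the choice of the points in $\mathcal C_k^\pm\cap\mathcal K_\theta$. Moreover, let $\gamma>1$ and suppose that for every slope $t\in[\tan(\frac\pi4-\frac\theta2),\tan(\frac\pi4+\frac\theta2)]$ the function $f_t=\big(m^{-1/2}+(nt)^{-1/2}\big)^{-1}$ satisfies the $\gamma$-condition, that is, $f_t$ is continuous, lies between two positive constants, and there is a constant $C$ (which may depend on $t$) such that $$\int_I|f_t-(f_t)_I|\,dx\le C|I|^\gamma,\qquad (f_t)_I=\frac1{|I|}\int_I f_t\,dx,$$ for every interval $I\subset(0,L)$. Then for every $\delta\in[\frac1\gamma,1]$ $$1=\frac{\pi k}{2}\left(\int_0^L\Big((\alpha_k^\pm m)^{-1/2}+(\beta_k^\pm n)^{-1/2}\Big)^{-1}dx\right)^{-1}+O(k^{\delta-1})\qquad(k\to\infty),$$ again uniformly with respect to the choice of the points $(\alpha_k^\pm,\beta_k^\pm)\in\mathcal C_k^\pm\cap\mathcal K_\theta$. -/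

import Mathlib

open Set

noncomputable section

/-- `u` is a classical (`C²` up to the boundary) solution of the Dirichlet problem
`-u'' = α m u⁺ - β n u⁻` on `(0, L)`, `u 0 = u L = 0`, and `u'` is its derivative.
Here `u⁺ = max u 0` and `u⁻ = max (-u) 0`. -/
structure IsFucikSolution (m n : ℝ → ℝ) (L α β : ℝ) (u u' : ℝ → ℝ) : Prop where
  hasDeriv : ∀ x ∈ Icc 0 L, HasDerivWithinAt u (u' x) (Icc 0 L) x
  hasDeriv_deriv : ∀ x ∈ Icc 0 L,
    HasDerivWithinAt u' (-(α * m x * max (u x) 0 - β * n x * max (-u x) 0)) (Icc 0 L) x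
  left_zero : u 0 = 0
  right_zero : u L = 0

/-- The curve `C_k⁺`: the pairs `(α, β)` with a solution that has exactly `k` zeros in `(0, L)`
and positive slope at the origin (in particular, a nontrivial one). -/
def fucikCurvePlus (m n : ℝ → ℝ) (L : ℝ) (k : ℕ) : Set (ℝ × ℝ) :=
  {p | ∃ u u' : ℝ → ℝ, IsFucikSolution m n L p.1 p.2 u u' ∧
    {x ∈ Ioo 0 L | u x = 0}.encard = k ∧ 0 < u' 0}

/-- The curve `C_k⁻`: the pairs `(α, β)` with a solution that has exactly `k` zeros in `(0, L)`
and negative slope at the origin. -/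
def fucikCurveMinus (m n : ℝ → ℝ) (L : ℝ) (k : ℕ) : Set (ℝ × ℝ) :=
  {p | ∃ u u' : ℝ → ℝ, IsFucikSolution m n L p.1 p.2 u u' ∧
    {x ∈ Ioo 0 L | u x = 0}.encard = k ∧ u' 0 < 0}

/-- The slopes of the rays that lie between the two rays through the origin which form an angle
`θ` with each other and are symmetric to each other with respect to the diagonal. -/
def coneSlopes (θ : ℝ) : Set ℝ :=
  Icc (Real.tan (Real.pi / 4 - θ / 2)) (Real.tan (Real.pi / 4 + θ / 2))

/-- The closed region `K_θ` of the open first quadrant between these two rays. -/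
def fucikCone (θ : ℝ) : Set (ℝ × ℝ) :=
  {p | 0 < p.1 ∧ 0 < p.2 ∧ p.2 / p.1 ∈ coneSlopes θ}

/-- The mean value of `f` on the interval from `a` to `b`. -/
def intervalMean (f : ℝ → ℝ) (a b : ℝ) : ℝ := (b - a)⁻¹ * ∫ x in a..b, f x

/-- The `γ`-condition on `(0, L)`: `f` is continuous, lies between two positive constants, and
belongs to the Morrey-Campanato space of exponent `γ`. -/
def GammaCondition (γ L : ℝ) (f : ℝ → ℝ) : Prop :=
  ContinuousOn f (Icc 0 L) ∧
  (∃ m₁ m₂ : ℝ, 0 < m₁ ∧ ∀ x ∈ Icc 0 L, m₁ ≤ f x ∧ f x ≤ m₂) ∧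
  ∃ C : ℝ, ∀ a b : ℝ, 0 ≤ a → a < b → b ≤ L →
    ∫ x in a..b, |f x - intervalMean f a b| ≤ C * (b - a) ^ γ

/-- The function `(m ^ (-1/2) + (n t) ^ (-1/2))⁻¹`. -/
def combinedWeight (m n : ℝ → ℝ) (t : ℝ) (x : ℝ) : ℝ :=
  ((m x) ^ (-(1 / 2) : ℝ) + (n x * t) ^ (-(1 / 2) : ℝ))⁻¹

/-- The integral of `((α m) ^ (-1/2) + (β n) ^ (-1/2))⁻¹` over `(0, L)`. -/
def fucikIntegral (m n : ℝ → ℝ) (L α β : ℝ) : ℝ :=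
  ∫ x in (0 : ℝ)..L, ((α * m x) ^ (-(1 / 2) : ℝ) + (β * n x) ^ (-(1 / 2) : ℝ))⁻¹

end

/-! ### Sign, slope and length of a single nodal interval. -/

namespace IsFucikSolution

variable {m n : ℝ → ℝ} {L α β : ℝ} {u u' : ℝ → ℝ}

/-! Put A = (αm)^(-1/2) and B = (βn)^(-1/2). Comparison with a sine arch of the same length shows
that a positive nodal interval has length exactly π A(ξ) for some interior ξ (`exists_length_eq`),
and a negative one π B(ζ). Two neighbouring intervals thus have joint length π (A(ξ) + B(ζ)), so the
integral of (A + B)⁻¹ over them is π up to the relative oscillation η of A and B. The k + 1 nodal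
intervals form about k/2 such pairs, so the whole integral is πk/2 + O(1) + O(kη)
(`abs_integral_inv_add_sub_le`).

Relative oscillation is unaffected by the factors α and β, and the cone bounds β/α on both sides.
Hence all nodal lengths are comparable and each is O(1/k), uniformly in the cone. Uniform continuity
gives η → 0, which is the first claim.

For the rate, Campanato's embedding makes each f_t Hölder of exponent γ - 1. Since 1/f_t = m^(-1/2)
+ t^(-1/2) n^(-1/2), two distinct slopes t suffice to recover the Hölder bound for both summands.
Then η = O(k^(1-γ)), and the relative error O(k⁻¹ + k^(1-γ)) is O(k^(δ-1)) because γ + 1/γ ≥ 2. -/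

theorem neg (h : IsFucikSolution m n L α β u u') :
    IsFucikSolution n m L β α (fun x => -u x) (fun x => -u' x) where
  hasDeriv x hx := (h.hasDeriv x hx).fun_neg
  hasDeriv_deriv x hx := by
    refine (h.hasDeriv_deriv x hx).fun_neg.congr_deriv ?_
    rw [neg_neg]; ring_nf
  left_zero := by simp [h.left_zero]
  right_zero := by simp [h.right_zero]

theorem continuousOn (h : IsFucikSolution m n L α β u u') : ContinuousOn u (Icc 0 L) :=
  fun x hx => (h.hasDeriv x hx).continuousWithinAt

theorem continuousOn_deriv (h : IsFucikSolution m n L α β u u') : ContinuousOn u' (Icc 0 L) :=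
  fun x hx => (h.hasDeriv_deriv x hx).continuousWithinAt

theorem hasDerivAt (h : IsFucikSolution m n L α β u u') {x : ℝ} (hx : x ∈ Ioo 0 L) :
    HasDerivAt u (u' x) x :=
  (h.hasDeriv x (Ioo_subset_Icc_self hx)).hasDerivAt (Icc_mem_nhds hx.1 hx.2)

theorem hasDerivAt_deriv (h : IsFucikSolution m n L α β u u') {x : ℝ} (hx : x ∈ Ioo 0 L)
    (hu : 0 < u x) : HasDerivAt u' (-(α * m x * u x)) x := by
  have := (h.hasDeriv_deriv x (Ioo_subset_Icc_self hx)).hasDerivAt (Icc_mem_nhds hx.1 hx.2)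
  rwa [max_eq_left hu.le, max_eq_right (by linarith), mul_zero, sub_zero] at this

variable {a b : ℝ}

/-- A solution that leaves a point `a` with positive slope stays positive up to its next zero. -/
theorem pos_of_deriv_pos (h : IsFucikSolution m n L α β u u') (ha : 0 ≤ a) (hb : b ≤ L)
    (hua : u a = 0) (hu'a : 0 < u' a) (hne : ∀ x ∈ Ioo a b, u x ≠ 0) :
    ∀ x ∈ Ioo a b, 0 < u x := by
  intro x hx
  by_contra! hneg
  have hsub : Ioo a b ⊆ Icc 0 L := fun y hy => ⟨ha.trans hy.1.le, hy.2.le.trans hb⟩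
  have hxneg : u x < 0 := lt_of_le_of_ne hneg (hne x hx)
  -- One negative value forces u ≤ 0 throughout, since u has no zero to cross. The difference
  -- quotients at `a` are then nonpositive, against u'(a) > 0.
  have hall : ∀ y ∈ Ioo a b, u y ≤ 0 := by
    intro y hy
    by_contra! hy0
    obtain ⟨w, hw, hw0⟩ := isPreconnected_Ioo.intermediate_value hx hy
      (h.continuousOn.mono hsub) (show (0 : ℝ) ∈ Icc (u x) (u y) from ⟨hneg, hy0.le⟩)
    exact hne w hw hw0
  have hab : a < b := hx.1.trans hx.2
  have hd : HasDerivWithinAt u (u' a) (Ioo a b) a :=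
    (h.hasDeriv a ⟨ha, hab.le.trans hb⟩).mono hsub
  rw [hasDerivWithinAt_iff_tendsto_slope' (by simp)] at hd
  have : (nhdsWithin a (Ioo a b)).NeBot := by
    rw [nhdsWithin_Ioo_eq_nhdsGT hab]; infer_instance
  refine hu'a.not_ge (le_of_tendsto hd ?_)
  filter_upwards [self_mem_nhdsWithin] with y hy
  rw [slope_def_field, hua, sub_zero]
  exact div_nonpos_of_nonpos_of_nonneg (hall y hy) (sub_nonneg.2 hy.1.le)

/-- At the right end of a positive nodal interval the slope is negative. -/
theorem deriv_neg_of_pos (h : IsFucikSolution m n L α β u u') (ha : 0 ≤ a) (hab : a < b)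
    (hb : b ≤ L) (hq : ∀ x ∈ Icc 0 L, 0 < α * m x) (hua : u a = 0) (hub : u b = 0)
    (hpos : ∀ x ∈ Ioo a b, 0 < u x) : u' b < 0 := by
  have hsub : Icc a b ⊆ Icc 0 L := Icc_subset_Icc ha hb
  have hsub' : Ioo a b ⊆ Ioo 0 L := Ioo_subset_Ioo ha hb
  -- Rolle gives u'(c) = 0; concavity makes u' strictly decreasing, so u'(b) < u'(c) = 0.
  obtain ⟨c, hc, hc0⟩ := exists_hasDerivAt_eq_zero hab (h.continuousOn.mono hsub)
    (hua.trans hub.symm) (fun x hx => h.hasDerivAt (hsub' hx))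
  have hanti : StrictAntiOn u' (Icc a b) := by
    refine strictAntiOn_of_deriv_neg (convex_Icc a b) (h.continuousOn_deriv.mono hsub) ?_
    intro x hx
    rw [interior_Icc] at hx
    rw [(h.hasDerivAt_deriv (hsub' hx) (hpos x hx)).deriv, neg_lt_zero]
    exact mul_pos (hq x (Ioo_subset_Icc_self (hsub' hx))) (hpos x hx)
  rw [← hc0]
  exact hanti (Ioo_subset_Icc_self hc) (right_mem_Icc.2 hab.le) hc.2

/-- Sturm comparison with a sine wave of the same nodal length: the frequency is attained. -/
theorem exists_length_eq (h : IsFucikSolution m n L α β u u') (ha : 0 ≤ a) (hab : a < b)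
    (hb : b ≤ L) (hua : u a = 0) (hub : u b = 0) (hpos : ∀ x ∈ Ioo a b, 0 < u x) :
    ∃ ξ ∈ Ioo a b, b - a = Real.pi * (α * m ξ) ^ (-(1 / 2) : ℝ) := by
  have hsub : Icc a b ⊆ Icc 0 L := Icc_subset_Icc ha hb
  have hsub' : Ioo a b ⊆ Ioo 0 L := Ioo_subset_Ioo ha hb
  have hl : 0 < b - a := sub_pos.2 hab
  set ω : ℝ := Real.pi / (b - a) with hω
  have hωpos : 0 < ω := div_pos Real.pi_pos hl
  have hωl : ω * (b - a) = Real.pi := by rw [hω]; field_simp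
  have hv : ∀ x, HasDerivAt (fun x => Real.sin (ω * (x - a))) (Real.cos (ω * (x - a)) * ω) x := by
    intro x
    simpa using (((hasDerivAt_id x).sub_const a).const_mul ω).sin
  have hv' : ∀ x, HasDerivAt (fun x => Real.cos (ω * (x - a)) * ω)
      (-Real.sin (ω * (x - a)) * ω * ω) x := by
    intro x
    simpa using ((((hasDerivAt_id x).sub_const a).const_mul ω).cos).mul_const ω
  -- Rolle for the Wronskian u'v - uv' with v = sin(ω(x - a)): it vanishes at both ends and has
  -- derivative (ω² - αm)uv, where uv > 0 inside. Hence αm(ξ) = ω².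
  obtain ⟨ξ, hξ, hξ0⟩ := exists_hasDerivAt_eq_zero hab
    (f := fun x => u' x * Real.sin (ω * (x - a)) - u x * (Real.cos (ω * (x - a)) * ω))
    (f' := fun x => (ω * ω - α * m x) * (u x * Real.sin (ω * (x - a))))
    (((h.continuousOn_deriv.mono hsub).mul (by fun_prop)).sub
      ((h.continuousOn.mono hsub).mul (by fun_prop)))
    (by simp [hua, hub, hωl])
    (by
      intro x hx
      refine (((h.hasDerivAt_deriv (hsub' hx) (hpos x hx)).mul (hv x)).sub
        ((h.hasDerivAt (hsub' hx)).mul (hv' x))).congr_deriv ?_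
      ring_nf)
  have hsin : 0 < Real.sin (ω * (ξ - a)) := by
    apply Real.sin_pos_of_pos_of_lt_pi (mul_pos hωpos (sub_pos.2 hξ.1))
    rw [← hωl]
    exact mul_lt_mul_of_pos_left (by linarith [hξ.2]) hωpos
  have hq : α * m ξ = ω ^ 2 := by
    rcases mul_eq_zero.1 hξ0 with h0 | h0
    · linarith [sq ω]
    · exact absurd h0 (mul_pos (hpos ξ hξ) hsin).ne'
  refine ⟨ξ, hξ, ?_⟩
  rw [hq, Real.rpow_neg (sq_nonneg ω), ← Real.sqrt_eq_rpow, Real.sqrt_sq hωpos.le, hω]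
  field_simp

end IsFucikSolution

/-! ### The sequence of zeros. -/

/-- The zeros of a solution, in increasing order, with the lengths of the nodal intervals. -/
theorem exists_nodes {L : ℝ} (k : ℕ) : ∀ {m n : ℝ → ℝ} {α β : ℝ} {u u' : ℝ → ℝ} {a : ℝ},
    IsFucikSolution m n L α β u u' → (∀ x ∈ Icc 0 L, 0 < α * m x) →
    (∀ x ∈ Icc 0 L, 0 < β * n x) → 0 ≤ a → a < L → u a = 0 → 0 < u' a →
    {x ∈ Ioo a L | u x = 0}.encard = k →
    ∃ z : ℕ → ℝ, z 0 = a ∧ z (k + 1) = L ∧ ∀ i ≤ k, z i < z (i + 1) ∧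
      ∃ ξ ∈ Ioo (z i) (z (i + 1)), z (i + 1) - z i =
        Real.pi * (if Even i then (α * m ξ) ^ (-(1 / 2) : ℝ) else (β * n ξ) ^ (-(1 / 2) : ℝ)) := by
  induction k with
  | zero =>
    intro m n α β u u' a h hm hn ha haL hua hu'a hk
    rw [Nat.cast_zero, encard_eq_zero, sep_eq_empty_iff_mem_false] at hk
    have hpos := h.pos_of_deriv_pos ha le_rfl hua hu'a hk
    obtain ⟨ξ, hξ, hl⟩ := h.exists_length_eq ha haL le_rfl hua h.right_zero hpos
    refine ⟨fun i => if i = 0 then a else L, by simp, by simp, fun i hi => ?_⟩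
    obtain rfl : i = 0 := by omega
    exact ⟨by simpa using haL, ξ, by simpa using hξ, by simpa using hl⟩
  | succ k ih =>
    intro m n α β u u' a h hm hn ha haL hua hu'a hk
    set S := {x ∈ Ioo a L | u x = 0} with hS
    have hfin : S.Finite := finite_of_encard_eq_coe hk
    have hne : S.Nonempty := by
      rw [← encard_ne_zero, hk]; simp
    obtain ⟨b, hbS, hbmin⟩ := exists_min_image S id hfin hne
    obtain ⟨⟨hab, hbL⟩, hub⟩ := hbS
    have hno : ∀ x ∈ Ioo a b, u x ≠ 0 := fun x hx hx0 =>
      (hbmin x ⟨⟨hx.1, hx.2.trans hbL⟩, hx0⟩).not_gt hx.2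
    have hpos := h.pos_of_deriv_pos ha hbL.le hua hu'a hno
    have hu'b := h.deriv_neg_of_pos ha hab hbL.le hm hua hub hpos
    obtain ⟨ξ, hξ, hl⟩ := h.exists_length_eq ha hab hbL.le hua hub hpos
    have hS' : {x ∈ Ioo b L | -u x = 0}.encard = k := by
      have hins : S = insert b {x ∈ Ioo b L | -u x = 0} := by
        ext x
        constructor
        · intro hx
          rcases eq_or_lt_of_le (hbmin x hx) with hbx | hbx
          · exact Or.inl hbx.symm
          · exact Or.inr ⟨⟨hbx, hx.1.2⟩, by simp [hx.2]⟩
        · rintro (rfl | hx)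
          · exact ⟨⟨hab, hbL⟩, hub⟩
          · exact ⟨⟨hab.trans hx.1.1, hx.1.2⟩, by simpa using hx.2⟩
      rw [hins, encard_insert_of_notMem (by simp)] at hk
      push_cast at hk
      exact (ENat.add_left_injective_of_ne_top (by simp)) hk
    -- Past the first zero b, -u starts with positive slope and solves the problem with the weights
    -- exchanged. Prepending `a` shifts the index by one, and the flipped parity undoes the
    -- exchange.
    obtain ⟨z, hz0, hzL, hz⟩ := ih h.neg hn hm (ha.trans hab.le) hbL (by simp [hub])
      (by simpa using hu'b) hS'
    refine ⟨fun i => Nat.casesOn i a z, rfl, hzL, fun i hi => ?_⟩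
    cases i with
    | zero => exact ⟨by simpa [hz0] using hab, ξ, by simpa [hz0] using hξ, by simpa [hz0] using hl⟩
    | succ i =>
      obtain ⟨h1, ζ, hζ, h2⟩ := hz i (by omega)
      refine ⟨h1, ζ, hζ, h2.trans ?_⟩
      by_cases hi : Even i <;> simp [Nat.even_add_one, hi]

/-! ### The integral over pairs of nodal intervals. -/

/-- Over two consecutive nodal intervals the integral of `(A + B)⁻¹` is close to `π`. -/
theorem abs_integral_inv_add_sub_pi_le {A B : ℝ → ℝ} {a b ξ ζ η : ℝ} (hab : a < b)
    (hA : ContinuousOn A (Icc a b)) (hB : ContinuousOn B (Icc a b))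
    (hApos : ∀ x ∈ Icc a b, 0 < A x) (hBpos : ∀ x ∈ Icc a b, 0 < B x)
    (hlen : b - a = Real.pi * (A ξ + B ζ))
    (hAη : ∀ x ∈ Icc a b, |A ξ - A x| ≤ η * A x) (hBη : ∀ x ∈ Icc a b, |B ζ - B x| ≤ η * B x) :
    |(∫ x in a..b, (A x + B x)⁻¹) - Real.pi| ≤ Real.pi * η := by
  have hl : 0 < b - a := sub_pos.2 hab
  have hpos : ∀ x ∈ Icc a b, 0 < A x + B x := fun x hx => add_pos (hApos x hx) (hBpos x hx)
  have hc : ContinuousOn (fun x => (A x + B x)⁻¹) (Icc a b) :=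
    (hA.add hB).inv₀ fun x hx => (hpos x hx).ne'
  have hi : IntervalIntegrable (fun x => (A x + B x)⁻¹) MeasureTheory.volume a b :=
    ContinuousOn.intervalIntegrable (by rwa [uIcc_of_le hab.le])
  have e : (∫ x in a..b, (A x + B x)⁻¹) - Real.pi =
      ∫ x in a..b, ((A x + B x)⁻¹ - Real.pi / (b - a)) := by
    rw [intervalIntegral.integral_sub hi (by simp), intervalIntegral.integral_const, smul_eq_mul]
    field_simp
  rw [e]
  have hle : ‖∫ x in a..b, ((A x + B x)⁻¹ - Real.pi / (b - a))‖ ≤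
      (Real.pi * η / (b - a)) * |b - a| := by
    refine intervalIntegral.norm_integral_le_of_norm_le_const fun x hx => ?_
    rw [uIoc_of_le hab.le] at hx
    have hx' := Ioc_subset_Icc_self hx
    have hp := hpos x hx'
    have h1 := abs_le.1 (hAη x hx')
    have h2 := abs_le.1 (hBη x hx')
    -- By `hlen`, π/(b - a) = (A(ξ) + B(ζ))⁻¹, so the difference is this constant times a relative
    -- error of size at most η.
    have e2 : (A x + B x)⁻¹ - Real.pi / (b - a) =
        Real.pi / (b - a) * (((A ξ - A x) + (B ζ - B x)) / (A x + B x)) := by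
      rw [hlen] at hl ⊢
      have : A ξ + B ζ ≠ 0 := by
        intro h0; rw [h0, mul_zero] at hl; exact hl.false
      field_simp
      ring
    rw [e2, Real.norm_eq_abs, abs_mul, abs_of_pos (div_pos Real.pi_pos hl), mul_div_right_comm]
    refine mul_le_mul_of_nonneg_left ?_ (div_pos Real.pi_pos hl).le
    rw [abs_div, abs_of_pos hp, div_le_iff₀ hp, abs_le]
    constructor <;> linarith
  rwa [abs_of_pos hl, div_mul_cancel₀ _ hl.ne', Real.norm_eq_abs] at hle

/-- Over one nodal interval the integral of `(A + B)⁻¹` is bounded. -/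
theorem integral_inv_add_le {A B : ℝ → ℝ} {a b ξ η : ℝ} (hab : a < b)
    (hApos : ∀ x ∈ Icc a b, 0 < A x) (hBpos : ∀ x ∈ Icc a b, 0 < B x)
    (hlen : b - a = Real.pi * A ξ) (hAη : ∀ x ∈ Icc a b, |A ξ - A x| ≤ η * A x) :
    |∫ x in a..b, (A x + B x)⁻¹| ≤ Real.pi * (1 + η) := by
  have hl : 0 < b - a := sub_pos.2 hab
  have hle : ‖∫ x in a..b, (A x + B x)⁻¹‖ ≤ (Real.pi * (1 + η) / (b - a)) * |b - a| := by
    refine intervalIntegral.norm_integral_le_of_norm_le_const fun x hx => ?_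
    rw [uIoc_of_le hab.le] at hx
    have hx' := Ioc_subset_Icc_self hx
    have hp := hApos x hx'
    have hq := hBpos x hx'
    have h1 := abs_le.1 (hAη x hx')
    rw [Real.norm_eq_abs, abs_of_pos (inv_pos.2 (add_pos hp hq)), inv_le_iff_one_le_mul₀
      (add_pos hp hq), div_mul_eq_mul_div, one_le_div₀ hl, hlen, mul_assoc]
    refine mul_le_mul_of_nonneg_left ?_ Real.pi_pos.le
    have hη : 0 ≤ η := by
      by_contra! hneg
      linarith [abs_nonneg (A ξ - A x), hAη x hx', mul_neg_of_neg_of_pos hneg hp]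
    nlinarith [mul_nonneg hη hq.le]
  rwa [abs_of_pos hl, div_mul_cancel₀ _ hl.ne', Real.norm_eq_abs] at hle

/-- If the lengths of `k + 1` adjacent intervals are given alternately by values of `π A` and
`π B`, the integral of `(A + B)⁻¹` is `π k / 2` up to a bounded error and the oscillation. -/
theorem abs_integral_inv_add_sub_le {A B : ℝ → ℝ} {z : ℕ → ℝ} {L h η : ℝ} {k : ℕ}
    (hA : ContinuousOn A (Icc 0 L)) (hB : ContinuousOn B (Icc 0 L))
    (hApos : ∀ x ∈ Icc 0 L, 0 < A x) (hBpos : ∀ x ∈ Icc 0 L, 0 < B x)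
    (hz0 : z 0 = 0) (hzL : z (k + 1) = L) (hz : ∀ i ≤ k, z i < z (i + 1))
    (hlen : ∀ i ≤ k, ∃ ξ ∈ Ioo (z i) (z (i + 1)),
      z (i + 1) - z i = Real.pi * (if Even i then A ξ else B ξ))
    (hh : ∀ i ≤ k, z (i + 1) - z i ≤ h / 2) (hη0 : 0 ≤ η)
    (hη : ∀ x ∈ Icc 0 L, ∀ y ∈ Icc 0 L, |x - y| ≤ h →
      |A x - A y| ≤ η * A y ∧ |B x - B y| ≤ η * B y) :
    |(∫ x in (0 : ℝ)..L, (A x + B x)⁻¹) - Real.pi * k / 2| ≤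
      2 * Real.pi + (k + 1) * (Real.pi * η) := by
  have hmono : ∀ i j, i ≤ j → j ≤ k + 1 → z i ≤ z j := by
    intro i j hij
    induction j, hij using Nat.le_induction with
    | base => exact fun _ => le_rfl
    | succ j hij ih => exact fun hj => (ih (by omega)).trans (hz j (by omega)).le
  have hmem : ∀ i j, i ≤ k + 1 → j ≤ k + 1 → Icc (z i) (z j) ⊆ Icc 0 L := fun i j hi hj =>
    Icc_subset_Icc (hz0 ▸ hmono 0 i (Nat.zero_le i) hi) (hzL ▸ hmono j (k + 1) hj le_rfl)
  have hint : ∀ i j, i ≤ j → j ≤ k + 1 →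
      IntervalIntegrable (fun x => (A x + B x)⁻¹) MeasureTheory.volume (z i) (z j) := by
    intro i j hij hj
    refine ContinuousOn.intervalIntegrable ?_
    rw [uIcc_of_le (hmono i j hij hj)]
    exact ((hA.add hB).inv₀ fun x hx => (add_pos (hApos x hx) (hBpos x hx)).ne').mono
      (hmem i j (hij.trans hj) hj)
  have hpair : ∀ j : ℕ, 2 * j ≤ k + 1 →
      |(∫ x in z 0..z (2 * j), (A x + B x)⁻¹) - j * Real.pi| ≤ j * (Real.pi * η) := by
    intro j
    induction j with
    | zero => simp
    | succ j ih =>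
      intro hj
      have h0 := ih (by omega)
      obtain ⟨ξ, hξ, h1⟩ := hlen (2 * j) (by omega)
      obtain ⟨ζ, hζ, h2⟩ := hlen (2 * j + 1) (by omega)
      rw [if_pos (by simp)] at h1
      rw [if_neg (by simp)] at h2
      have hl1 := hz (2 * j) (by omega)
      have hl2 := hz (2 * j + 1) (by omega)
      have hh1 := hh (2 * j) (by omega)
      have hh2 := hh (2 * j + 1) (by omega)
      have hsub := hmem (2 * j) (2 * j + 1 + 1) (by omega) (by omega)
      have hclose : ∀ w ∈ Icc (z (2 * j)) (z (2 * j + 1 + 1)),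
          ∀ x ∈ Icc (z (2 * j)) (z (2 * j + 1 + 1)), |w - x| ≤ h := by
        intro w hw x hx
        rw [abs_le]
        constructor <;> linarith [hw.1, hw.2, hx.1, hx.2]
      have hξ' : ξ ∈ Icc (z (2 * j)) (z (2 * j + 1 + 1)) := ⟨hξ.1.le, hξ.2.le.trans hl2.le⟩
      have hζ' : ζ ∈ Icc (z (2 * j)) (z (2 * j + 1 + 1)) := ⟨hl1.le.trans hζ.1.le, hζ.2.le⟩
      have h3 := abs_integral_inv_add_sub_pi_le (hl1.trans hl2) (hA.mono hsub) (hB.mono hsub)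
        (fun x hx => hApos x (hsub hx)) (fun x hx => hBpos x (hsub hx))
        (ξ := ξ) (ζ := ζ) (η := η) (by linarith)
        (fun x hx => (hη ξ (hsub hξ') x (hsub hx) (hclose ξ hξ' x hx)).1)
        (fun x hx => (hη ζ (hsub hζ') x (hsub hx) (hclose ζ hζ' x hx)).2)
      rw [show 2 * (j + 1) = 2 * j + 1 + 1 by ring, ← intervalIntegral.integral_add_adjacent_intervals
        (hint 0 (2 * j) (by omega) (by omega)) (hint (2 * j) (2 * j + 1 + 1) (by omega) (by omega))]
      push_cast
      rw [abs_le] at h0 h3 ⊢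
      constructor <;> linarith
  have hπ := Real.pi_pos
  have hπη : 0 ≤ Real.pi * η := mul_nonneg hπ.le hη0
  -- With k + 1 = 2j all intervals are paired, and jπ exceeds πk/2 by π/2. With k = 2j one interval
  -- is left over and costs at most π(1 + η).
  rcases Nat.even_or_odd' (k + 1) with ⟨j, hj | hj⟩
  · have h1 := hpair j hj.ge
    rw [← hj, hz0, hzL] at h1
    have hjk : (k : ℝ) + 1 = 2 * j := by exact_mod_cast hj
    have hk : (k : ℝ) = 2 * j - 1 := by linarith
    have hj0 : (0 : ℝ) ≤ j := Nat.cast_nonneg j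
    have := mul_nonneg hj0 hπη
    rw [hk]
    rw [abs_le] at h1 ⊢
    constructor <;> nlinarith
  · have hkj : k = 2 * j := by omega
    have h1 := hpair j (by omega)
    obtain ⟨ξ, hξ, h2⟩ := hlen (2 * j) (by omega)
    rw [if_pos (by simp)] at h2
    have hl1 := hz (2 * j) (by omega)
    have hh1 := hh (2 * j) (by omega)
    have hsub := hmem (2 * j) (2 * j + 1) (by omega) (by omega)
    have h3 := integral_inv_add_le hl1 (fun x hx => hApos x (hsub hx))
      (fun x hx => hBpos x (hsub hx)) h2 (η := η) (fun x hx =>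
        (hη ξ (hsub (Ioo_subset_Icc_self hξ)) x (hsub hx) (by
          rw [abs_le]
          constructor <;> linarith [hξ.1, hξ.2, hx.1, hx.2])).1)
    have h4 := intervalIntegral.integral_add_adjacent_intervals
      (hint 0 (2 * j) (by omega) (by omega)) (hint (2 * j) (2 * j + 1) (by omega) (by omega))
    rw [← hkj, hz0, hzL, hkj] at h4
    rw [hz0] at h1
    rw [show z (2 * j + 1) = L by rw [← hkj, hzL]] at h3
    have hk : (k : ℝ) = 2 * j := by exact_mod_cast hkj
    have hj0 : (0 : ℝ) ≤ j := Nat.cast_nonneg j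
    have := mul_nonneg hj0 hπη
    rw [hk, ← h4]
    rw [abs_le] at h1 h3 ⊢
    constructor <;> nlinarith

/-! ### From the γ-condition to Hölder continuity. -/

/-- Campanato's embedding on an interval, one dyadic step of the mean values. -/
theorem abs_intervalMean_sub_le {f : ℝ → ℝ} {a b c d D γ : ℝ} (hf : ContinuousOn f (Icc a b))
    (hac : a ≤ c) (hcd : c < d) (hdb : d ≤ b)
    (h : ∫ x in a..b, |f x - intervalMean f a b| ≤ D * (b - a) ^ γ) :
    |intervalMean f c d - intervalMean f a b| ≤ (d - c)⁻¹ * (D * (b - a) ^ γ) := by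
  have hab : a ≤ b := by linarith
  set M := intervalMean f a b with hM
  have hsub : uIcc c d ⊆ Icc a b := by
    rw [uIcc_of_le hcd.le]; exact Icc_subset_Icc hac hdb
  have hi : IntervalIntegrable f MeasureTheory.volume c d := (hf.mono hsub).intervalIntegrable
  have hg : ContinuousOn (fun x => |f x - M|) (Icc a b) := (hf.sub continuousOn_const).abs
  have hpos : 0 < d - c := sub_pos.2 hcd
  have e : intervalMean f c d - M = (d - c)⁻¹ * ∫ x in c..d, (f x - M) := by
    rw [intervalIntegral.integral_sub hi (by simp), intervalIntegral.integral_const, intervalMean,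
      smul_eq_mul]
    field_simp
  rw [e, abs_mul, abs_of_pos (inv_pos.2 hpos)]
  refine mul_le_mul_of_nonneg_left ?_ (inv_pos.2 hpos).le
  calc |∫ x in c..d, (f x - M)| ≤ ∫ x in c..d, |f x - M| :=
        intervalIntegral.abs_integral_le_integral_abs hcd.le
    _ ≤ ∫ x in a..b, |f x - M| := by
        refine intervalIntegral.integral_mono_interval hac hcd.le hdb
          (Filter.Eventually.of_forall fun x => abs_nonneg _) ?_
        exact ContinuousOn.intervalIntegrable (by rwa [uIcc_of_le hab])
    _ ≤ _ := h

theorem abs_intervalMean_sub_const_le {f : ℝ → ℝ} {a b v ε : ℝ} (hf : ContinuousOn f (Icc a b))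
    (hab : a < b) (h : ∀ x ∈ Icc a b, |f x - v| ≤ ε) : |intervalMean f a b - v| ≤ ε := by
  have hpos : 0 < b - a := sub_pos.2 hab
  have hi : IntervalIntegrable f MeasureTheory.volume a b :=
    ContinuousOn.intervalIntegrable (by rwa [uIcc_of_le hab.le])
  have e : intervalMean f a b - v = (b - a)⁻¹ * ∫ x in a..b, (f x - v) := by
    rw [intervalIntegral.integral_sub hi (by simp), intervalIntegral.integral_const, intervalMean,
      smul_eq_mul]
    field_simp
  have hle : ‖∫ x in a..b, (f x - v)‖ ≤ ε * |b - a| := by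
    refine intervalIntegral.norm_integral_le_of_norm_le_const fun x hx => ?_
    rw [uIoc_of_le hab.le] at hx
    exact h x (Ioc_subset_Icc_self hx)
  rw [e, abs_mul, abs_of_pos (inv_pos.2 hpos), inv_mul_le_iff₀ hpos, mul_comm]
  rwa [Real.norm_eq_abs, abs_of_pos hpos] at hle

/-- A continuous function in a Morrey-Campanato class is close to its mean values. -/
theorem abs_sub_intervalMean_le {f : ℝ → ℝ} {a b p D γ : ℝ} (hγ : 1 < γ)
    (hf : ContinuousOn f (Icc a b)) (hab : a < b) (hp : p ∈ Icc a b)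
    (h : ∀ c d : ℝ, a ≤ c → c < d → d ≤ b →
      ∫ x in c..d, |f x - intervalMean f c d| ≤ D * (d - c) ^ γ) :
    |intervalMean f a b - f p| ≤
      2 * D * (b - a) ^ (γ - 1) / (1 - (1 / 2 : ℝ) ^ (γ - 1)) := by
  have hl : 0 < b - a := sub_pos.2 hab
  have hap : 0 ≤ p - a := sub_nonneg.2 hp.1
  have hpb : 0 ≤ b - p := sub_nonneg.2 hp.2
  set r : ℝ := (1 / 2 : ℝ) ^ (γ - 1) with hr
  have hr1 : r < 1 := Real.rpow_lt_one (by norm_num) (by norm_num) (by linarith)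
  -- Contracting [a, b] towards p by halves keeps every interval inside [a, b] and containing p,
  -- even when p is an endpoint.
  set c : ℕ → ℝ := fun j => p - (p - a) * (1 / 2) ^ j with hc
  set d : ℕ → ℝ := fun j => p + (b - p) * (1 / 2) ^ j with hd
  have hq : ∀ j : ℕ, (0 : ℝ) < (1 / 2) ^ j := fun j => by positivity
  have hq1 : ∀ j : ℕ, ((1 / 2 : ℝ)) ^ j ≤ 1 := fun j => pow_le_one₀ (by norm_num) (by norm_num)
  have hdc : ∀ j, d j - c j = (b - a) * (1 / 2) ^ j := fun j => by simp only [hc, hd]; ring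
  have hcd : ∀ j, c j < d j := fun j => by
    rw [← sub_pos, hdc]; exact mul_pos hl (hq j)
  have hac : ∀ j, a ≤ c j := fun j => by
    have := mul_le_mul_of_nonneg_left (hq1 j) hap
    simp only [hc]; linarith
  have hdb : ∀ j, d j ≤ b := fun j => by
    have := mul_le_mul_of_nonneg_left (hq1 j) hpb
    simp only [hd]; linarith
  have hcc : ∀ j, c j ≤ c (j + 1) := fun j => by
    have := mul_nonneg hap (hq j).le
    simp only [hc, pow_succ]; linarith
  have hdd : ∀ j, d (j + 1) ≤ d j := fun j => by
    have := mul_nonneg hpb (hq j).le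
    simp only [hd, pow_succ]; linarith
  have hlim : Filter.Tendsto (fun j => intervalMean f (c j) (d j)) Filter.atTop (nhds (f p)) := by
    rw [Metric.tendsto_atTop]
    intro ε hε
    obtain ⟨s, hs, hfs⟩ := Metric.continuousWithinAt_iff.1 (hf p hp) (ε / 2) (by linarith)
    obtain ⟨N, hN⟩ := exists_pow_lt_of_lt_one (div_pos hs hl) (by norm_num : (1 / 2 : ℝ) < 1)
    refine ⟨N, fun j hj => ?_⟩
    have hjs : (b - a) * (1 / 2) ^ j < s := by
      have h1 : (1 / 2 : ℝ) ^ j ≤ (1 / 2) ^ N :=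
        pow_le_pow_of_le_one (by norm_num) (by norm_num) hj
      have := (lt_div_iff₀ hl).1 (h1.trans_lt hN)
      linarith
    have hle : |intervalMean f (c j) (d j) - f p| ≤ ε / 2 := by
      refine abs_intervalMean_sub_const_le (hf.mono (Icc_subset_Icc (hac j) (hdb j))) (hcd j) ?_
      intro x hx
      refine (hfs ⟨(hac j).trans hx.1, hx.2.trans (hdb j)⟩ ?_).le
      have h1 := mul_nonneg hap (hq j).le
      have h2 := mul_nonneg hpb (hq j).le
      have h3 := hx.1
      have h4 := hx.2
      simp only [hc, hd] at h3 h4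
      rw [Real.dist_eq, abs_lt]
      constructor <;> linarith
    rw [Real.dist_eq]
    linarith
  -- With ℓ the length at stage j, the bound (ℓ/2)⁻¹ D ℓ^γ = 2D ℓ^(γ-1) is geometric in j with ratio
  -- r < 1, because γ > 1.
  have hstep : ∀ j, dist (intervalMean f (c j) (d j)) (intervalMean f (c (j + 1)) (d (j + 1))) ≤
      2 * D * (b - a) ^ (γ - 1) * r ^ j := by
    intro j
    rw [dist_comm, Real.dist_eq]
    refine (abs_intervalMean_sub_le (hf.mono (Icc_subset_Icc (hac j) (hdb j))) (hcc j)
      (hcd (j + 1)) (hdd j) (h _ _ (hac j) (hcd j) (hdb j))).trans_eq ?_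
    have hw : 0 < (b - a) * (1 / 2) ^ j := mul_pos hl (hq j)
    have e1 : ((b - a) * (1 / 2) ^ j) ^ γ =
        ((b - a) * (1 / 2) ^ j) ^ (γ - 1) * ((b - a) * (1 / 2) ^ j) := by
      rw [← Real.rpow_add_one hw.ne']; ring_nf
    have e2 : ((b - a) * (1 / 2) ^ j) ^ (γ - 1) = (b - a) ^ (γ - 1) * r ^ j := by
      rw [Real.mul_rpow hl.le (hq j).le, hr, ← Real.rpow_natCast, ← Real.rpow_natCast,
        ← Real.rpow_mul (by norm_num), ← Real.rpow_mul (by norm_num), mul_comm (j : ℝ)]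
    rw [hdc, hdc, e1, e2, pow_succ]
    field_simp
  have := dist_le_of_le_geometric_of_tendsto₀ r _ hr1 hstep hlim
  simpa [hc, hd, Real.dist_eq] using this

/-- A function that satisfies the `γ`-condition is Hölder continuous of exponent `γ - 1`. -/
theorem GammaCondition.exists_holder {γ L : ℝ} {f : ℝ → ℝ} (hγ : 1 < γ)
    (h : GammaCondition γ L f) :
    ∃ C : ℝ, 0 ≤ C ∧ ∀ x ∈ Icc 0 L, ∀ y ∈ Icc 0 L, |f x - f y| ≤ C * |x - y| ^ (γ - 1) := by
  obtain ⟨hf, -, D, hD⟩ := h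
  have hr1 : (1 / 2 : ℝ) ^ (γ - 1) < 1 :=
    Real.rpow_lt_one (by norm_num) (by norm_num) (by linarith)
  have key : ∀ x ∈ Icc 0 L, ∀ y ∈ Icc 0 L, x < y → |f x - f y| ≤
      4 * |D| / (1 - (1 / 2 : ℝ) ^ (γ - 1)) * |x - y| ^ (γ - 1) := by
    intro x hx y hy hxy
    have hsub : Icc x y ⊆ Icc 0 L := Icc_subset_Icc hx.1 hy.2
    have hD' : ∀ c d : ℝ, x ≤ c → c < d → d ≤ y →
        ∫ s in c..d, |f s - intervalMean f c d| ≤ |D| * (d - c) ^ γ := fun c d h1 h2 h3 =>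
      (hD c d (hx.1.trans h1) h2 (h3.trans hy.2)).trans
        (mul_le_mul_of_nonneg_right (le_abs_self D) (Real.rpow_nonneg (sub_pos.2 h2).le _))
    have h1 := abs_sub_intervalMean_le hγ (hf.mono hsub) hxy (left_mem_Icc.2 hxy.le) hD'
    have h2 := abs_sub_intervalMean_le hγ (hf.mono hsub) hxy (right_mem_Icc.2 hxy.le) hD'
    rw [abs_sub_comm x y, abs_of_pos (sub_pos.2 hxy)]
    have h3 := abs_sub_le (f x) (intervalMean f x y) (f y)
    rw [abs_sub_comm (f x) (intervalMean f x y)] at h3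
    calc |f x - f y| ≤ 2 * (2 * |D| * (y - x) ^ (γ - 1) / (1 - (1 / 2 : ℝ) ^ (γ - 1))) := by
          linarith
      _ = _ := by ring
  have hC : 0 ≤ 4 * |D| / (1 - (1 / 2 : ℝ) ^ (γ - 1)) :=
    div_nonneg (by positivity) (sub_pos.2 hr1).le
  refine ⟨_, hC, fun x hx y hy => ?_⟩
  rcases lt_trichotomy x y with hxy | rfl | hxy
  · exact key x hx y hy hxy
  · rw [sub_self, abs_zero]
    exact mul_nonneg hC (Real.rpow_nonneg (abs_nonneg _) _)
  · rw [abs_sub_comm (f x), abs_sub_comm x]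
    exact key y hy x hx hxy

theorem GammaCondition.exists_holder_inv {γ L : ℝ} {f : ℝ → ℝ} (hγ : 1 < γ)
    (h : GammaCondition γ L f) :
    ∃ C : ℝ, 0 ≤ C ∧ ∀ x ∈ Icc 0 L, ∀ y ∈ Icc 0 L,
      |(f x)⁻¹ - (f y)⁻¹| ≤ C * |x - y| ^ (γ - 1) := by
  obtain ⟨C, hC0, hC⟩ := h.exists_holder hγ
  obtain ⟨-, ⟨c, c', hc, hf⟩, -⟩ := h
  refine ⟨C / (c * c), by positivity, fun x hx y hy => ?_⟩
  have hfx := (hf x hx).1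
  have hfy := (hf y hy).1
  have hx0 := hc.trans_le hfx
  have hy0 := hc.trans_le hfy
  rw [inv_sub_inv hx0.ne' hy0.ne', abs_div, abs_of_pos (mul_pos hx0 hy0), abs_sub_comm,
    div_mul_eq_mul_div]
  exact div_le_div₀ (mul_nonneg hC0 (Real.rpow_nonneg (abs_nonneg _) _)) (hC x hx y hy)
    (mul_pos hc hc) (mul_le_mul hfx hfy hc.le hx0.le)

/-- Two `γ`-conditions with different slopes give Hölder continuity of both summands. -/
theorem exists_holder_rpow_of_gammaCondition {m n : ℝ → ℝ} {γ L s t : ℝ} (hγ : 1 < γ)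
    (hn : ∀ x ∈ Icc 0 L, 0 < n x) (hs : 0 < s) (hst : s < t)
    (h₁ : GammaCondition γ L (combinedWeight m n s))
    (h₂ : GammaCondition γ L (combinedWeight m n t)) :
    ∃ C : ℝ, 0 ≤ C ∧ ∀ x ∈ Icc 0 L, ∀ y ∈ Icc 0 L,
      |m x ^ (-(1 / 2) : ℝ) - m y ^ (-(1 / 2) : ℝ)| ≤ C * |x - y| ^ (γ - 1) ∧
      |n x ^ (-(1 / 2) : ℝ) - n y ^ (-(1 / 2) : ℝ)| ≤ C * |x - y| ^ (γ - 1) := by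
  obtain ⟨C₁, hC₁0, hC₁⟩ := h₁.exists_holder_inv hγ
  obtain ⟨C₂, hC₂0, hC₂⟩ := h₂.exists_holder_inv hγ
  set σ := s ^ (-(1 / 2) : ℝ) with hσ
  set τ := t ^ (-(1 / 2) : ℝ) with hτ
  have hσ0 : 0 < σ := Real.rpow_pos_of_pos hs _
  have hτσ : 0 < σ - τ :=
    sub_pos.2 (Real.rpow_lt_rpow_of_neg hs hst (by norm_num))
  have hD : 0 ≤ (C₁ + C₂) / (σ - τ) := div_nonneg (add_nonneg hC₁0 hC₂0) hτσ.le
  refine ⟨C₁ + (σ + 1) * ((C₁ + C₂) / (σ - τ)), by positivity, fun x hx y hy => ?_⟩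
  have e : ∀ r : ℝ, 0 < r → ∀ w ∈ Icc 0 L, (combinedWeight m n r w)⁻¹ =
      m w ^ (-(1 / 2) : ℝ) + r ^ (-(1 / 2) : ℝ) * n w ^ (-(1 / 2) : ℝ) := by
    intro r hr w hw
    rw [combinedWeight, inv_inv, Real.mul_rpow (hn w hw).le hr.le, mul_comm (n w ^ _)]
  have h1 := hC₁ x hx y hy
  have h2 := hC₂ x hx y hy
  rw [e s hs x hx, e s hs y hy] at h1
  rw [e t (hs.trans hst) x hx, e t (hs.trans hst) y hy] at h2
  rw [← hσ] at h1
  rw [← hτ] at h2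
  set a := m x ^ (-(1 / 2) : ℝ)
  set a' := m y ^ (-(1 / 2) : ℝ)
  set b := n x ^ (-(1 / 2) : ℝ)
  set b' := n y ^ (-(1 / 2) : ℝ)
  set d := |x - y| ^ (γ - 1)
  have hd : 0 ≤ d := Real.rpow_nonneg (abs_nonneg _) _
  -- Subtracting the bounds for the two slopes cancels the m-part and leaves (σ - τ)(b - b').
  have hb : |b - b'| ≤ (C₁ + C₂) / (σ - τ) * d := by
    rw [div_mul_eq_mul_div, le_div_iff₀ hτσ, ← abs_of_pos hτσ, ← abs_mul]
    rw [abs_le] at h1 h2 ⊢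
    constructor <;> linarith
  have ha : |a - a'| ≤ C₁ * d + σ * |b - b'| := by
    have := abs_sub (a + σ * b - (a' + σ * b')) (σ * (b - b'))
    rw [abs_mul, abs_of_pos hσ0] at this
    calc |a - a'| = |a + σ * b - (a' + σ * b') - σ * (b - b')| := by ring_nf
      _ ≤ _ := by linarith
  refine ⟨?_, ?_⟩
  · calc |a - a'| ≤ C₁ * d + σ * |b - b'| := ha
      _ ≤ C₁ * d + σ * ((C₁ + C₂) / (σ - τ) * d) := by gcongr
      _ ≤ _ := by linarith [mul_nonneg hD hd]
  · linarith [mul_nonneg hC₁0 hd, mul_nonneg hσ0.le (mul_nonneg hD hd)]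

/-! ### Uniform estimates in the cone. -/

/-- Rescaling does not change relative oscillations, so the asymptotic bound for the integral
needs only comparability of the two weights. -/
theorem abs_fucikIntegral_sub_le_of_mem_plus {m n : ℝ → ℝ} {L α β c C p η : ℝ} {k : ℕ}
    (hL : 0 < L) (hm : ContinuousOn m (Icc 0 L)) (hn : ContinuousOn n (Icc 0 L))
    (hαm : ∀ x ∈ Icc 0 L, 0 < α * m x) (hβn : ∀ x ∈ Icc 0 L, 0 < β * n x)
    (hc : 0 < c) (hp : 0 < p)
    (hA : ∀ x ∈ Icc 0 L, c * p ≤ (α * m x) ^ (-(1 / 2) : ℝ) ∧ (α * m x) ^ (-(1 / 2) : ℝ) ≤ C * p)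
    (hB : ∀ x ∈ Icc 0 L, c * p ≤ (β * n x) ^ (-(1 / 2) : ℝ) ∧ (β * n x) ^ (-(1 / 2) : ℝ) ≤ C * p)
    (hmem : (α, β) ∈ fucikCurvePlus m n L k) (hη0 : 0 ≤ η)
    (hη : ∀ x ∈ Icc 0 L, ∀ y ∈ Icc 0 L, |x - y| ≤ 2 * (C / c * L) / (k + 1) →
      |(α * m x) ^ (-(1 / 2) : ℝ) - (α * m y) ^ (-(1 / 2) : ℝ)| ≤
        η * (α * m y) ^ (-(1 / 2) : ℝ) ∧
      |(β * n x) ^ (-(1 / 2) : ℝ) - (β * n y) ^ (-(1 / 2) : ℝ)| ≤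
        η * (β * n y) ^ (-(1 / 2) : ℝ)) :
    |fucikIntegral m n L α β - Real.pi * k / 2| ≤ 2 * Real.pi + (k + 1) * (Real.pi * η) := by
  obtain ⟨u, u', hu, hk, hu'0⟩ := hmem
  obtain ⟨z, hz0, hzL, hz⟩ := exists_nodes k hu hαm hβn le_rfl hL hu.left_zero hu'0 hk
  have hmono : ∀ i j, i ≤ j → j ≤ k + 1 → z i ≤ z j := by
    intro i j hij
    induction j, hij using Nat.le_induction with
    | base => exact fun _ => le_rfl
    | succ j hij ih => exact fun hj => (ih (by omega)).trans (hz j (by omega)).1.le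
  have hlen : ∀ i ≤ k, Real.pi * (c * p) ≤ z (i + 1) - z i ∧
      z (i + 1) - z i ≤ Real.pi * (C * p) := by
    intro i hi
    obtain ⟨-, ξ, hξ, h⟩ := hz i hi
    have hξ' : ξ ∈ Icc 0 L :=
      ⟨(hz0 ▸ hmono 0 i (Nat.zero_le i) (by omega) : 0 ≤ z i).trans hξ.1.le,
        hξ.2.le.trans (hzL ▸ hmono (i + 1) (k + 1) (by omega) le_rfl)⟩
    rw [h]
    constructor <;> refine mul_le_mul_of_nonneg_left ?_ Real.pi_pos.le <;> split_ifs
    exacts [(hA ξ hξ').1, (hB ξ hξ').1, (hA ξ hξ').2, (hB ξ hξ').2]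
  -- The lengths add up to L, which bounds the unknown scale p. Each length is then at most
  -- (C/c)L/(k + 1); the factor 2 in `h` covers a pair.
  have hsum : (k + 1) * (Real.pi * (c * p)) ≤ L := by
    have h1 := Finset.card_nsmul_le_sum (Finset.range (k + 1)) (fun i => z (i + 1) - z i)
      (Real.pi * (c * p)) (fun i hi => (hlen i (by simpa [Nat.lt_succ_iff] using hi)).1)
    rw [Finset.sum_range_sub, hz0, hzL, Finset.card_range, nsmul_eq_mul] at h1
    push_cast at h1
    linarith
  have hC : 0 ≤ C := by
    have := hA 0 ⟨le_rfl, hL.le⟩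
    exact (pos_of_mul_pos_left ((mul_pos hc hp).trans_le (this.1.trans this.2)) hp.le).le
  have hpow : ∀ f : ℝ → ℝ, ContinuousOn f (Icc 0 L) → (∀ x ∈ Icc 0 L, 0 < f x) →
      ContinuousOn (fun x => f x ^ (-(1 / 2) : ℝ)) (Icc 0 L) := fun f hf hf0 =>
    hf.rpow_const fun x hx => Or.inl (hf0 x hx).ne'
  refine abs_integral_inv_add_sub_le (h := 2 * (C / c * L) / (k + 1))
    (hpow _ (continuousOn_const.mul hm) hαm) (hpow _ (continuousOn_const.mul hn) hβn)
    (fun x hx => Real.rpow_pos_of_pos (hαm x hx) _) (fun x hx => Real.rpow_pos_of_pos (hβn x hx) _)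
    hz0 hzL (fun i hi => (hz i hi).1) (fun i hi => (hz i hi).2) (fun i hi => ?_) hη0 hη
  have hk0 : (0 : ℝ) < k + 1 := by positivity
  calc z (i + 1) - z i ≤ Real.pi * (C * p) := (hlen i hi).2
    _ = C / c * ((k + 1) * (Real.pi * (c * p))) / (k + 1) := by field_simp
    _ ≤ C / c * L / (k + 1) := by gcongr
    _ = _ := by ring

theorem fucikIntegral_swap (m n : ℝ → ℝ) (L α β : ℝ) :
    fucikIntegral n m L β α = fucikIntegral m n L α β := by
  simp only [fucikIntegral, add_comm]

theorem mem_fucikCurvePlus_swap {m n : ℝ → ℝ} {L α β : ℝ} {k : ℕ}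
    (h : (α, β) ∈ fucikCurveMinus m n L k) : (β, α) ∈ fucikCurvePlus n m L k := by
  obtain ⟨u, u', hu, hk, hu'0⟩ := h
  exact ⟨_, _, hu.neg, by simpa using hk, by simpa using hu'0⟩

theorem coneSlopes_endpoints {θ : ℝ} (hθ : θ ∈ Ioo 0 (Real.pi / 2)) :
    0 < Real.tan (Real.pi / 4 - θ / 2) ∧
      Real.tan (Real.pi / 4 - θ / 2) < Real.tan (Real.pi / 4 + θ / 2) := by
  have hπ := Real.pi_pos
  obtain ⟨h0, h1⟩ := hθ
  exact ⟨Real.tan_pos_of_pos_of_lt_pi_div_two (by linarith) (by linarith),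
    Real.tan_lt_tan_of_nonneg_of_lt_pi_div_two (by linarith) (by linarith) (by linarith)⟩

theorem exists_bounds_rpow {m : ℝ → ℝ} {L : ℝ} (hL : 0 < L) (hm : ContinuousOn m (Icc 0 L))
    (hpos : ∀ x ∈ Icc 0 L, 0 < m x) :
    ∃ c C : ℝ, 0 < c ∧ ∀ x ∈ Icc 0 L,
      c ≤ m x ^ (-(1 / 2) : ℝ) ∧ m x ^ (-(1 / 2) : ℝ) ≤ C := by
  have hc : ContinuousOn (fun x => m x ^ (-(1 / 2) : ℝ)) (Icc 0 L) :=
    hm.rpow_const fun x hx => Or.inl (hpos x hx).ne'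
  have hne : (Icc 0 L).Nonempty := nonempty_Icc.2 hL.le
  obtain ⟨x, hx, hmin⟩ := isCompact_Icc.exists_isMinOn hne hc
  obtain ⟨y, hy, hmax⟩ := isCompact_Icc.exists_isMaxOn hne hc
  exact ⟨_, _, Real.rpow_pos_of_pos (hpos x hx) _, fun w hw => ⟨hmin hw, hmax hw⟩⟩

/-- The constants depend only on m, n, L and θ, which is the source of all uniformity: oscillation
is measured on the unscaled weights, and the cone enters through bounds on β/α. The curve with
negative initial slope is reduced to the other by u ↦ -u. -/
theorem exists_abs_fucikIntegral_sub_le {m n : ℝ → ℝ} {L θ : ℝ} (hL : 0 < L)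
    (hm : ContinuousOn m (Icc 0 L)) (hn : ContinuousOn n (Icc 0 L))
    (hm0 : ∀ x ∈ Icc 0 L, 0 < m x) (hn0 : ∀ x ∈ Icc 0 L, 0 < n x)
    (hθ : θ ∈ Ioo 0 (Real.pi / 2)) :
    ∃ R c : ℝ, 0 < R ∧ 0 < c ∧ ∀ k : ℕ, ∀ α β : ℝ,
      (α, β) ∈ fucikCurvePlus m n L k ∪ fucikCurveMinus m n L k → (α, β) ∈ fucikCone θ →
      ∀ η : ℝ, 0 ≤ η →
      (∀ x ∈ Icc 0 L, ∀ y ∈ Icc 0 L, |x - y| ≤ R / (k + 1) →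
        |m x ^ (-(1 / 2) : ℝ) - m y ^ (-(1 / 2) : ℝ)| ≤ η * c ∧
        |n x ^ (-(1 / 2) : ℝ) - n y ^ (-(1 / 2) : ℝ)| ≤ η * c) →
      |fucikIntegral m n L α β - Real.pi * k / 2| ≤ 2 * Real.pi + (k + 1) * (Real.pi * η) := by
  obtain ⟨c₁, C₁, hc₁, hb₁⟩ := exists_bounds_rpow hL hm hm0
  obtain ⟨c₂, C₂, hc₂, hb₂⟩ := exists_bounds_rpow hL hn hn0
  obtain ⟨ht₀, ht⟩ := coneSlopes_endpoints hθ
  set t₀ := Real.tan (Real.pi / 4 - θ / 2) with ht₀_def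
  set t₁ := Real.tan (Real.pi / 4 + θ / 2) with ht₁_def
  set σ := t₀ ^ (-(1 / 2) : ℝ) with hσ
  set τ := t₁ ^ (-(1 / 2) : ℝ) with hτ
  have hσ0 : 0 < σ := Real.rpow_pos_of_pos ht₀ _
  have hτ0 : 0 < τ := Real.rpow_pos_of_pos (ht₀.trans ht) _
  have h0 : (0 : ℝ) ∈ Icc 0 L := ⟨le_rfl, hL.le⟩
  have hC₁ : 0 < C₁ := hc₁.trans_le ((hb₁ 0 h0).1.trans (hb₁ 0 h0).2)
  have hC₂ : 0 < C₂ := hc₂.trans_le ((hb₂ 0 h0).1.trans (hb₂ 0 h0).2)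
  set c := min c₁ (τ * c₂) with hc_def
  set C := max C₁ (σ * C₂) with hC_def
  have hc : 0 < c := lt_min hc₁ (mul_pos hτ0 hc₂)
  have hC : 0 < C := lt_max_of_lt_left hC₁
  -- Comparability of the scaled weights fixes R, whereas the second witness is the lower bound of
  -- the unscaled ones, turning absolute into relative oscillation.
  refine ⟨2 * (C / c * L), min c₁ c₂, by positivity, lt_min hc₁ hc₂, ?_⟩
  intro k α β hmem ⟨hα, hβ, hslope⟩ η hη0 hη
  simp only at hα hβ hslope
  set p := α ^ (-(1 / 2) : ℝ) with hp_def
  have hp : 0 < p := Real.rpow_pos_of_pos hα _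
  have hq : 0 < β ^ (-(1 / 2) : ℝ) := Real.rpow_pos_of_pos hβ _
  have hβp : β ^ (-(1 / 2) : ℝ) = (β / α) ^ (-(1 / 2) : ℝ) * p := by
    rw [← Real.mul_rpow (div_pos hβ hα).le hα.le, div_mul_cancel₀ _ hα.ne']
  have hτ' : τ ≤ (β / α) ^ (-(1 / 2) : ℝ) :=
    Real.rpow_le_rpow_of_nonpos (div_pos hβ hα) hslope.2 (by norm_num)
  have hσ' : (β / α) ^ (-(1 / 2) : ℝ) ≤ σ :=
    Real.rpow_le_rpow_of_nonpos ht₀ hslope.1 (by norm_num)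
  have eA : ∀ x ∈ Icc 0 L, (α * m x) ^ (-(1 / 2) : ℝ) = p * m x ^ (-(1 / 2) : ℝ) := fun x hx =>
    Real.mul_rpow hα.le (hm0 x hx).le
  have eB : ∀ x ∈ Icc 0 L, (β * n x) ^ (-(1 / 2) : ℝ) =
      β ^ (-(1 / 2) : ℝ) * n x ^ (-(1 / 2) : ℝ) := fun x hx =>
    Real.mul_rpow hβ.le (hn0 x hx).le
  have hA : ∀ x ∈ Icc 0 L, c * p ≤ (α * m x) ^ (-(1 / 2) : ℝ) ∧
      (α * m x) ^ (-(1 / 2) : ℝ) ≤ C * p := by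
    intro x hx
    rw [eA x hx, mul_comm p]
    exact ⟨mul_le_mul_of_nonneg_right ((min_le_left _ _).trans (hb₁ x hx).1) hp.le,
      mul_le_mul_of_nonneg_right ((hb₁ x hx).2.trans (le_max_left _ _)) hp.le⟩
  have hB : ∀ x ∈ Icc 0 L, c * p ≤ (β * n x) ^ (-(1 / 2) : ℝ) ∧
      (β * n x) ^ (-(1 / 2) : ℝ) ≤ C * p := by
    intro x hx
    rw [eB x hx, hβp, mul_right_comm]
    exact ⟨mul_le_mul_of_nonneg_right ((min_le_right _ _).trans
        (mul_le_mul hτ' (hb₂ x hx).1 hc₂.le (hτ0.le.trans hτ'))) hp.le,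
      mul_le_mul_of_nonneg_right ((mul_le_mul hσ' (hb₂ x hx).2
        (hc₂.le.trans (hb₂ x hx).1) hσ0.le).trans (le_max_right _ _)) hp.le⟩
  have hrel : ∀ x ∈ Icc 0 L, ∀ y ∈ Icc 0 L, |x - y| ≤ 2 * (C / c * L) / (k + 1) →
      |(α * m x) ^ (-(1 / 2) : ℝ) - (α * m y) ^ (-(1 / 2) : ℝ)| ≤
        η * (α * m y) ^ (-(1 / 2) : ℝ) ∧
      |(β * n x) ^ (-(1 / 2) : ℝ) - (β * n y) ^ (-(1 / 2) : ℝ)| ≤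
        η * (β * n y) ^ (-(1 / 2) : ℝ) := by
    intro x hx y hy hxy
    obtain ⟨h1, h2⟩ := hη x hx y hy hxy
    rw [eA x hx, eA y hy, eB x hx, eB y hy, ← mul_sub, ← mul_sub, abs_mul, abs_mul,
      abs_of_pos hp, abs_of_pos hq, mul_left_comm, mul_left_comm η]
    exact ⟨mul_le_mul_of_nonneg_left (h1.trans (mul_le_mul_of_nonneg_left
        ((min_le_left _ _).trans (hb₁ y hy).1) hη0)) hp.le,
      mul_le_mul_of_nonneg_left (h2.trans (mul_le_mul_of_nonneg_left
        ((min_le_right _ _).trans (hb₂ y hy).1) hη0)) hq.le⟩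
  have hαm : ∀ x ∈ Icc 0 L, 0 < α * m x := fun x hx => mul_pos hα (hm0 x hx)
  have hβn : ∀ x ∈ Icc 0 L, 0 < β * n x := fun x hx => mul_pos hβ (hn0 x hx)
  rcases hmem with hmem | hmem
  · exact abs_fucikIntegral_sub_le_of_mem_plus hL hm hn hαm hβn hc hp hA hB hmem hη0 hrel
  · rw [← fucikIntegral_swap]
    exact abs_fucikIntegral_sub_le_of_mem_plus hL hn hm hβn hαm hc hp hB hA
      (mem_fucikCurvePlus_swap hmem) hη0 fun x hx y hy hxy => (hrel x hx y hy hxy).symm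

theorem exists_uniform_modulus {f : ℝ → ℝ} {L ε : ℝ} (hf : ContinuousOn f (Icc 0 L))
    (hε : 0 < ε) :
    ∃ d > 0, ∀ x ∈ Icc 0 L, ∀ y ∈ Icc 0 L, |x - y| < d → |f x - f y| ≤ ε := by
  obtain ⟨d, hd, h⟩ := Metric.uniformContinuousOn_iff.1
    (isCompact_Icc.uniformContinuousOn_of_continuous hf) ε hε
  exact ⟨d, hd, fun x hx y hy hxy => (h x hx y hy hxy).le⟩

theorem fucikIntegral_asymptotic {m n : ℝ → ℝ} {L θ : ℝ} (hL : 0 < L)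
    (hm : ContinuousOn m (Icc 0 L)) (hn : ContinuousOn n (Icc 0 L))
    (hm0 : ∀ x ∈ Icc 0 L, 0 < m x) (hn0 : ∀ x ∈ Icc 0 L, 0 < n x)
    (hθ : θ ∈ Ioo 0 (Real.pi / 2)) {ε : ℝ} (hε : 0 < ε) :
    ∃ K : ℕ, 1 ≤ K ∧ ∀ k : ℕ, K ≤ k → ∀ α β : ℝ,
      (α, β) ∈ fucikCurvePlus m n L k ∪ fucikCurveMinus m n L k → (α, β) ∈ fucikCone θ →
      |fucikIntegral m n L α β - Real.pi * k / 2| < ε * (Real.pi * k / 2) := by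
  obtain ⟨R, c, hR, hc, H⟩ := exists_abs_fucikIntegral_sub_le hL hm hn hm0 hn0 hθ
  obtain ⟨d₁, hd₁, h₁⟩ := exists_uniform_modulus (L := L) (ε := ε / 8 * c)
    (hm.rpow_const fun x hx => Or.inl (hm0 x hx).ne') (by positivity)
  obtain ⟨d₂, hd₂, h₂⟩ := exists_uniform_modulus (L := L) (ε := ε / 8 * c)
    (hn.rpow_const fun x hx => Or.inl (hn0 x hx).ne') (by positivity)
  obtain ⟨K₁, hK₁⟩ := exists_nat_gt (R / min d₁ d₂)
  -- The condition εk > 8 makes 2 < εk/4, while the oscillation term ε(k + 1)/8 is at most εk/4.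
  obtain ⟨K₂, hK₂⟩ := exists_nat_gt (8 / ε)
  have hd : 0 < min d₁ d₂ := lt_min hd₁ hd₂
  refine ⟨max (max K₁ K₂) 1, le_max_right _ _, fun k hk α β hmem hcone => ?_⟩
  have hk1 : (1 : ℝ) ≤ k := by exact_mod_cast (le_max_right _ _).trans hk
  have hkK₁ : (K₁ : ℝ) ≤ k := by
    exact_mod_cast ((le_max_left _ _).trans (le_max_left _ _)).trans hk
  have hkK₂ : (K₂ : ℝ) ≤ k := by
    exact_mod_cast ((le_max_right _ _).trans (le_max_left _ _)).trans hk
  have hlt : R / (k + 1) < min d₁ d₂ := by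
    rw [div_lt_iff₀ (by linarith), mul_comm, ← div_lt_iff₀ hd]
    linarith
  have hb := H k α β hmem hcone (ε / 8) (by positivity) fun x hx y hy hxy =>
    ⟨h₁ x hx y hy (hxy.trans_lt (hlt.trans_le (min_le_left _ _))),
      h₂ x hx y hy (hxy.trans_lt (hlt.trans_le (min_le_right _ _)))⟩
  have hk8 : 8 < ε * k := by
    have := (div_lt_iff₀ hε).1 (hK₂.trans_le hkK₂)
    linarith
  have hεk : ε ≤ ε * k := le_mul_of_one_le_right hε.le hk1
  calc _ ≤ 2 * Real.pi + (k + 1) * (Real.pi * (ε / 8)) := hb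
    _ = Real.pi * (2 + ε * k / 8 + ε / 8) := by ring
    _ < Real.pi * (ε * k / 2) := mul_lt_mul_of_pos_left (by linarith) Real.pi_pos
    _ = _ := by ring

/-! ### Both asymptotic statements. -/

theorem theorem1p2 (L : ℝ) (hL : 0 < L) (m n : ℝ → ℝ)
    (hm : ContinuousOn m (Set.Icc 0 L)) (hn : ContinuousOn n (Set.Icc 0 L))
    (hm_pos : ∃ c : ℝ, 0 < c ∧ ∀ x ∈ Set.Icc 0 L, c ≤ m x)
    (hn_pos : ∃ c : ℝ, 0 < c ∧ ∀ x ∈ Set.Icc 0 L, c ≤ n x)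
    (θ : ℝ) (hθ : θ ∈ Set.Ioo 0 (Real.pi / 2)) :
    -- the quotient of the two sides of `1 ∼ …` tends to `1`, uniformly in the cone
    (∀ ε : ℝ, 0 < ε → ∃ K : ℕ, ∀ k : ℕ, K ≤ k →
      ∀ α β : ℝ, (α, β) ∈ fucikCurvePlus m n L k ∪ fucikCurveMinus m n L k →
        (α, β) ∈ fucikCone θ →
        |1 / (Real.pi * k / 2 * (fucikIntegral m n L α β)⁻¹) - 1| < ε) ∧
    -- the error term, uniformly in the cone
    (∀ γ : ℝ, 1 < γ → (∀ t ∈ coneSlopes θ, GammaCondition γ L (combinedWeight m n t)) →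
      ∀ δ ∈ Set.Icc (1 / γ) 1, ∃ C : ℝ, ∃ K : ℕ, ∀ k : ℕ, K ≤ k →
        ∀ α β : ℝ, (α, β) ∈ fucikCurvePlus m n L k ∪ fucikCurveMinus m n L k →
          (α, β) ∈ fucikCone θ →
          |1 - Real.pi * k / 2 * (fucikIntegral m n L α β)⁻¹| ≤ C * (k : ℝ) ^ (δ - 1)) := by
  have hm0 : ∀ x ∈ Icc 0 L, 0 < m x := fun x hx =>
    let ⟨_, hc, h⟩ := hm_pos; hc.trans_le (h x hx)
  have hn0 : ∀ x ∈ Icc 0 L, 0 < n x := fun x hx =>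
    let ⟨_, hc, h⟩ := hn_pos; hc.trans_le (h x hx)
  have hπ := Real.pi_pos
  constructor
  · intro ε hε
    obtain ⟨K, hK1, hK⟩ := fucikIntegral_asymptotic hL hm hn hm0 hn0 hθ hε
    refine ⟨K, fun k hk α β hmem hcone => ?_⟩
    have hk0 : (0 : ℝ) < k := by exact_mod_cast hK1.trans hk
    have hx : 0 < Real.pi * k / 2 := by positivity
    rw [one_div, mul_inv, inv_inv, mul_comm, ← div_eq_mul_inv, div_sub_one hx.ne', abs_div,
      abs_of_pos hx, div_lt_iff₀ hx]
    exact hK k hk α β hmem hcone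
  · intro γ hγ hΓ δ hδ
    obtain ⟨ht₀, ht⟩ := coneSlopes_endpoints hθ
    obtain ⟨D, hD0, hD⟩ := exists_holder_rpow_of_gammaCondition hγ hn0 ht₀ ht
      (hΓ _ (left_mem_Icc.2 ht.le)) (hΓ _ (right_mem_Icc.2 ht.le))
    -- The first part with ε = 1/2 gives I ≥ πk/4, the lower bound for the denominator.
    obtain ⟨K, hK1, hK⟩ := fucikIntegral_asymptotic hL hm hn hm0 hn0 hθ
      (ε := 1 / 2) (by norm_num)
    obtain ⟨R, c, hR, hc, H⟩ := exists_abs_fucikIntegral_sub_le hL hm hn hm0 hn0 hθ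
    -- Division by πk/4 turns 2π into 8/k and (k + 1)πη into 4η(k + 1)/k ≤ 8η.
    refine ⟨8 + 8 * (D / c * R ^ (γ - 1)), K, fun k hk α β hmem hcone => ?_⟩
    have hk1 : (1 : ℝ) ≤ k := by exact_mod_cast hK1.trans hk
    have hk0 : (0 : ℝ) < k := by linarith
    set η : ℝ := D / c * (R / (k + 1)) ^ (γ - 1) with hη
    have hη0 : 0 ≤ η := by positivity
    have hb := H k α β hmem hcone η hη0 fun x hx y hy hxy => by
      have hle : D * |x - y| ^ (γ - 1) ≤ η * c := by
        rw [hη, mul_right_comm, div_mul_cancel₀ _ hc.ne']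
        exact mul_le_mul_of_nonneg_left
          (Real.rpow_le_rpow (abs_nonneg _) hxy (by linarith)) hD0
      exact ⟨(hD x hx y hy).1.trans hle, (hD x hx y hy).2.trans hle⟩
    have hI := hK k hk α β hmem hcone
    set I := fucikIntegral m n L α β
    have hπk : 0 < Real.pi * k := mul_pos hπ hk0
    have hI4 : Real.pi * k / 4 ≤ I := by
      rw [abs_lt] at hI
      linarith [hI.1]
    have hI0 : 0 < I := lt_of_lt_of_le (by positivity) hI4
    have hγ0 : 0 < γ := by linarith
    -- Since δ ≥ 1/γ, this reduces to γ + 1/γ ≥ 2.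
    have hγδ : -(γ - 1) ≤ δ - 1 := by
      have h1 : 2 ≤ γ + 1 / γ := by
        rw [← sub_nonneg, show γ + 1 / γ - 2 = (γ - 1) ^ 2 / γ by field_simp; ring]
        positivity
      linarith [hδ.1]
    have hδ0 : 0 < δ := lt_of_lt_of_le (by positivity) hδ.1
    have hpow₁ : (k : ℝ)⁻¹ ≤ (k : ℝ) ^ (δ - 1) := by
      rw [← Real.rpow_neg_one]
      exact Real.rpow_le_rpow_of_exponent_le hk1 (by linarith)
    have hpow₂ : η ≤ D / c * R ^ (γ - 1) * (k : ℝ) ^ (δ - 1) := by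
      rw [hη, mul_assoc]
      refine mul_le_mul_of_nonneg_left ?_ (by positivity)
      calc (R / (k + 1)) ^ (γ - 1) ≤ (R / k) ^ (γ - 1) :=
            Real.rpow_le_rpow (by positivity) (by gcongr; linarith) (by linarith)
        _ = R ^ (γ - 1) * (k : ℝ) ^ (-(γ - 1)) := by
            rw [Real.div_rpow hR.le hk0.le, Real.rpow_neg hk0.le, div_eq_mul_inv]
        _ ≤ _ := mul_le_mul_of_nonneg_left (Real.rpow_le_rpow_of_exponent_le hk1 hγδ)
            (by positivity)
    rw [← div_eq_mul_inv, one_sub_div hI0.ne', abs_div, abs_of_pos hI0]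
    calc |I - Real.pi * k / 2| / I ≤
          (2 * Real.pi + (k + 1) * (Real.pi * η)) / (Real.pi * k / 4) :=
          div_le_div₀ (by positivity) hb (by positivity) hI4
      _ = 8 * (k : ℝ)⁻¹ + 4 * ((k + 1) / k * η) := by field_simp; ring
      _ ≤ 8 * (k : ℝ)⁻¹ + 4 * (2 * η) := by
          gcongr
          rw [div_le_iff₀ hk0]
          linarith
      _ ≤ _ := by linarith
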